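/- **Theorem 1.** Let $\mathcal G=(\mathcal S,\mathcal A,\mathcal B,P,r,\gamma,d_0)$ be a two-player zero-sum discounted Markov game with finite non-empty state space $\mathcal S$ and action spaces $\mathcal A,\mathcal B$, transition function $P(\cdot\mid s,a,b)$, rewards $r(s,a,b)\in[-1,1]$, discount factor $\gamma\in[0,1)$ and initial distribution $d_0$. Player 1 (policies $\mu:\mathcal S\to\Delta_{\mathcal A}$) maximizes and player 2 (policies $\nu:\mathcal S\to\Delta_{\mathcal B}$) minimizes $\langle d_0,V^{\mu,\nu}\rangle$, where $V^{\mu,\nu}(s)=\mathbb E_{\mu,\nu}[\sum_{t\ge 0}\gamma^t r(S_t,A_t,B_t)\mid S_0=s]$. Put $$d^{\mu,\nu}(s')=(1-\gamma)\,\mathbb E_{\mu,\nu}\Big[\sum_{t\ge0}\gamma^t\mathbf 1_{\{S_t=s'\}}\,\Big|\,S_0\sim d_0\Big],\quad \mathrm{br}(\nu)=\operatorname*{argmax}_{\mu}\langle d_0,V^{\mu,\nu}\rangle,\quad \mathrm{br}(\mu)=\operatorname*{argmin}_{\nu}\langle d_0,V^{\mu,\nu}\rangle,$$ $$\mathrm{Nash\text{-}Gap}(\mu,\nu)=\max_{\mu'}\langle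 d_0,V^{\mu',\nu}\rangle-\min_{\nu'}\langle d_0,V^{\mu,\nu'}\rangle .$$ Let $(\mu^E,\nu^E)$ be a Nash equilibrium, i.e. $\mu^E\in\mathrm{br}(\nu^E)$ and $\nu^E\in\mathrm{br}(\mu^E)$. Let $\mathcal D$ consist of $N\ge1$ independent trajectories $(S_0,A_0,B_0),\dots,(S_{H-1},A_{H-1},B_{H-1})$ of the process generated by $(\mu^E,\nu^E)$ from $S_0\sim d_0$, where the length $H\in\{1,2,\dots\}$ is independent of the process with $\mathbb P(H=h)=(1-\gamma)\gamma^{h-1}$. Let $N(s),N(s,a),N(s,b)$ be the total numbers of occurrences of $s$, $(s,a)$, $(s,b)$ in $\mathcal D$, and let the behavior-cloning pair be $\widehat\mu(a\mid s)=N(s,a)/N(s)$, $\widehat\nu(b\mid s)=N(s,b)/N(s)$ if $N(s)>0$, and $\widehat\mu(a\mid s)=1/|\mathcal A|$, $\widehat\nu(b\mid s)=1/|\mathcal B|$ otherwise. Then for every $\delta\in(0,1)$, with probability at least $1-\delta$, $$\mathrm{Nash\text{-}Gap}(\widehat\mu,\widehat\nu)\le \mathcal C_{\max}\,\frac{8}{(1-\gamma)^2}\sqrt{\frac{|\mathcal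 S|\,|\mathcal A_{\max}|\,\log^2(2|\mathcal S|/\delta)}{N}},$$ where $|\mathcal A_{\max}|=\max\{|\mathcal A|,|\mathcal B|\}$ and, with $\rho=d^{\mu^E,\nu^E}$, $$\mathcal C_{\max}=\max\Big\{\sup_{\mu}\sup_{\nu^\star\in\mathrm{br}(\mu)}\Big\|\frac{d^{\mu^E,\nu^\star}}{\rho}\Big\|_\infty,\ \sup_{\nu}\sup_{\mu^\star\in\mathrm{br}(\nu)}\Big\|\frac{d^{\mu^\star,\nu^E}}{\rho}\Big\|_\infty\Big\}\in[1,\infty]$$ (conventions: $0/0=0$, and $x/0=\infty$ for $x>0$). -/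

import Mathlib

open MeasureTheory ProbabilityTheory
open scoped ENNReal BigOperators

noncomputable section

/-- An infinite-horizon discounted two-player zero-sum Markov game with state space `S`, action
spaces `A` (maximizing player 1) and `B` (minimizing player 2), transition kernel `P`,
reward `r` with values in `[-1, 1]`, discount factor `γ ∈ [0, 1)` and initial distribution `d0`. -/
structure ZeroSumMarkovGame (S A B : Type*) where
  P : S → A → B → PMF S
  r : S → A → B → ℝ
  r_mem : ∀ s a b, r s a b ∈ Set.Icc (-1 : ℝ) 1
  γ : ℝ
  γ_nonneg : 0 ≤ γ
  γ_lt_one : γ < 1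
  d0 : PMF S

/-- A trajectory: the finite list of the visited states together with the actions played there. -/
abbrev Trajectory (S A B : Type*) := List (S × A × B)

/-- Trajectories over finite spaces form a countable set; it carries the discrete σ-algebra. -/
instance Trajectory.instMeasurableSpace (S A B : Type*) : MeasurableSpace (Trajectory S A B) := ⊤

namespace ZeroSumMarkovGame

section

variable {S A B : Type*}

/-- Law of `(s, A_t, B_t)` when the players act independently with `μ(· | s)` and `ν(· | s)`. -/
def actLaw (μ : S → PMF A) (ν : S → PMF B) (s : S) : PMF (S × A × B) :=
  (μ s).bind fun a => (ν s).map fun b => (s, a, b)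

/-- Law of the first `n` steps `(S_0, A_0, B_0), …, (S_{n-1}, A_{n-1}, B_{n-1})` of the process
generated by `(μ, ν)` from the state `S_0 = s`. -/
def rollout (G : ZeroSumMarkovGame S A B) (μ : S → PMF A) (ν : S → PMF B) :
    ℕ → S → PMF (Trajectory S A B)
  | 0, _ => PMF.pure []
  | n + 1, s => (actLaw μ ν s).bind fun x =>
      (G.P x.1 x.2.1 x.2.2).bind fun s' =>
        (rollout G μ ν n s').map fun l => x :: l

/-- Law of `(S_t, A_t, B_t)` under `(μ, ν)` given `S_0 = s`. -/
def stepLaw (G : ZeroSumMarkovGame S A B) (μ : S → PMF A) (ν : S → PMF B) :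
    ℕ → S → PMF (S × A × B)
  | 0, s => actLaw μ ν s
  | t + 1, s => (actLaw μ ν s).bind fun x =>
      (G.P x.1 x.2.1 x.2.2).bind fun s' => stepLaw G μ ν t s'

/-- `stepLaw` is the marginal of `rollout` at each time. -/
theorem rollout_map_getElem? (G : ZeroSumMarkovGame S A B) (μ : S → PMF A) (ν : S → PMF B)
    (n t : ℕ) (h : t < n) (s : S) :
    (G.rollout μ ν n s).map (fun l => l[t]?) = (G.stepLaw μ ν t s).map some := by
  induction n generalizing t s with
  | zero => omega
  | succ n ih =>
    cases t with
    | zero =>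
      simp only [rollout, stepLaw, PMF.map_bind, PMF.map_comp]
      have : ∀ x : S × A × B, ((fun l : Trajectory S A B => l[0]?) ∘ fun l => x :: l)
          = Function.const _ (some x) := fun x => rfl
      simp only [this, PMF.map_const, PMF.bind_const]
      rfl
    | succ t =>
      simp only [rollout, stepLaw, PMF.map_bind, PMF.map_comp]
      congr 1; funext x; congr 1; funext s'
      exact ih t (by omega) s'

/-- Value function `V^{μ,ν}(s) = E_{μ,ν}[∑_t γ^t r(S_t, A_t, B_t) | S_0 = s]`. -/
def value [Fintype S] [Fintype A] [Fintype B] (G : ZeroSumMarkovGame S A B)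
    (μ : S → PMF A) (ν : S → PMF B) (s : S) : ℝ :=
  ∑' t : ℕ, G.γ ^ t * ∑ x : S × A × B, (G.stepLaw μ ν t s x).toReal * G.r x.1 x.2.1 x.2.2

/-- `⟨d0, V^{μ,ν}⟩`. -/
def J [Fintype S] [Fintype A] [Fintype B] (G : ZeroSumMarkovGame S A B)
    (μ : S → PMF A) (ν : S → PMF B) : ℝ :=
  ∑ s, (G.d0 s).toReal * G.value μ ν s

/-- State visitation distribution
`d^{μ,ν}(s') = (1 - γ) E_{μ,ν}[∑_t γ^t 1{S_t = s'} | S_0 ∼ d0]`. -/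
def occupancy (G : ZeroSumMarkovGame S A B) (μ : S → PMF A) (ν : S → PMF B) (s' : S) : ℝ :=
  (1 - G.γ) * ∑' t : ℕ, G.γ ^ t * ((G.d0.bind fun s => (G.stepLaw μ ν t s).map Prod.fst) s').toReal

/-- Best responses of the maximizing player to `ν`. -/
def brMax [Fintype S] [Fintype A] [Fintype B] (G : ZeroSumMarkovGame S A B) (ν : S → PMF B) :
    Set (S → PMF A) :=
  {μ | ∀ μ' : S → PMF A, G.J μ' ν ≤ G.J μ ν}

/-- Best responses of the minimizing player to `μ`. -/
def brMin [Fintype S] [Fintype A] [Fintype B] (G : ZeroSumMarkovGame S A B) (μ : S → PMF A) :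
    Set (S → PMF B) :=
  {ν | ∀ ν' : S → PMF B, G.J μ ν ≤ G.J μ ν'}

/-- Nash equilibrium: the two policies are best responses to each other. -/
def IsNash [Fintype S] [Fintype A] [Fintype B] (G : ZeroSumMarkovGame S A B)
    (μ : S → PMF A) (ν : S → PMF B) : Prop :=
  μ ∈ G.brMax ν ∧ ν ∈ G.brMin μ

/-- Nash gap `max_{μ'} ⟨d0, V^{μ',ν}⟩ - min_{ν'} ⟨d0, V^{μ,ν'}⟩`. -/
def nashGap [Fintype S] [Fintype A] [Fintype B] (G : ZeroSumMarkovGame S A B)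
    (μ : S → PMF A) (ν : S → PMF B) : ℝ :=
  (⨆ μ' : S → PMF A, G.J μ' ν) - ⨅ ν' : S → PMF B, G.J μ ν'

/-- The Nash gap is `⟨d0, V^{μ⋆,ν} - V^{μ,ν⋆}⟩` for all best responses `μ⋆` and `ν⋆`. -/
theorem nashGap_eq [Fintype S] [Fintype A] [Fintype B] (G : ZeroSumMarkovGame S A B)
    (μ μs : S → PMF A) (ν νs : S → PMF B) (hμ : μs ∈ G.brMax ν) (hν : νs ∈ G.brMin μ) :
    G.nashGap μ ν = G.J μs ν - G.J μ νs := by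
  have h1 : IsGreatest (Set.range fun μ' => G.J μ' ν) (G.J μs ν) :=
    ⟨⟨μs, rfl⟩, by rintro _ ⟨μ', rfl⟩; exact hμ μ'⟩
  have h2 : IsLeast (Set.range fun ν' => G.J μ ν') (G.J μ νs) :=
    ⟨⟨νs, rfl⟩, by rintro _ ⟨ν', rfl⟩; exact hν ν'⟩
  unfold nashGap iSup iInf
  rw [h1.csSup_eq, h2.csInf_eq]

/-- `‖d / ρ‖_∞`, with `0 / 0 = 0` and `x / 0 = ∞` for `x > 0`. -/
def supRatio (d ρ : S → ℝ) : ℝ≥0∞ :=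
  ⨆ s, ENNReal.ofReal (d s) / ENNReal.ofReal (ρ s)

/-- All policy deviation concentrability coefficient of the expert pair `(μE, νE)`. -/
def Cmax [Fintype S] [Fintype A] [Fintype B] (G : ZeroSumMarkovGame S A B)
    (μE : S → PMF A) (νE : S → PMF B) : ℝ≥0∞ :=
  max (⨆ μ : S → PMF A, ⨆ νs ∈ G.brMin μ, supRatio (G.occupancy μE νs) (G.occupancy μE νE))
    (⨆ ν : S → PMF B, ⨆ μs ∈ G.brMax ν, supRatio (G.occupancy μs νE) (G.occupancy μE νE))

/-- The success probability `1 - γ` of the random length. -/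
def stopProb (G : ZeroSumMarkovGame S A B) : unitInterval :=
  ⟨1 - G.γ, by have := G.γ_lt_one; linarith, by have := G.γ_nonneg; linarith⟩

/-- Law of a trajectory: the length is `H = n + 1` with probability `(1 - γ) γ ^ n`, i.e.
`H ∼ Geo(1 - γ)` on `{1, 2, …}`, independently of the process, which is started from `d0` and
recorded for `H` steps. -/
def trajLaw (G : ZeroSumMarkovGame S A B) (μ : S → PMF A) (ν : S → PMF B) :
    PMF (Trajectory S A B) :=
  (geometricMeasure G.stopProb).toPMF.bind fun n =>
    G.d0.bind fun s => G.rollout μ ν (n + 1) s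

/-- Law of a data set of `N` independent trajectories. -/
def dataLaw (G : ZeroSumMarkovGame S A B) (μ : S → PMF A) (ν : S → PMF B) (N : ℕ) :
    Measure (Fin N → Trajectory S A B) :=
  Measure.pi fun _ => (G.trajLaw μ ν).toMeasure

end

end ZeroSumMarkovGame

namespace BehaviorCloning

section

variable {S A B : Type*}

/-- `N(s)`: number of visits of `s` in the data. -/
def visits [DecidableEq S] {N : ℕ} (D : Fin N → Trajectory S A B) (s : S) : ℕ :=
  ∑ k, (D k).countP fun x => x.1 = s

/-- `N(s, c)`: number of visits of `s` at which the action read off by `act` was `c`. -/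
def actionVisits [DecidableEq S] {C : Type*} [DecidableEq C] {N : ℕ}
    (D : Fin N → Trajectory S A B) (act : S × A × B → C) (s : S) (c : C) : ℕ :=
  ∑ k, (D k).countP fun x => x.1 = s ∧ act x = c

theorem sum_actionVisits [DecidableEq S] {C : Type*} [DecidableEq C] [Fintype C] {N : ℕ}
    (D : Fin N → Trajectory S A B) (act : S × A × B → C) (s : S) :
    ∑ c, actionVisits D act s c = visits D s := by
  unfold actionVisits visits
  rw [Finset.sum_comm]
  refine Finset.sum_congr rfl fun k _ => ?_
  induction D k with
  | nil => simp
  | cons x l ih =>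
    simp only [List.countP_cons, Finset.sum_add_distrib, ih]
    congr 1
    by_cases h : x.1 = s <;> simp [h]

/-- Empirical policy: `N(s, c) / N(s)` if `N(s) > 0`, and uniform otherwise. -/
def empPolicy [DecidableEq S] {C : Type*} [DecidableEq C] [Fintype C] [Nonempty C] {N : ℕ}
    (D : Fin N → Trajectory S A B) (act : S × A × B → C) (s : S) : PMF C :=
  if h : visits D s = 0 then PMF.uniformOfFintype C
  else PMF.ofFintype (fun c => (actionVisits D act s c : ℝ≥0∞) / (visits D s : ℝ≥0∞)) (by
    simp only [div_eq_mul_inv]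
    rw [← Finset.sum_mul, ← Nat.cast_sum, sum_actionVisits]
    exact ENNReal.mul_inv_cancel (by exact_mod_cast h) (ENNReal.natCast_ne_top _))

/-- Behavior-cloning policy of player 1. -/
def muHat [DecidableEq S] [DecidableEq A] [Fintype A] [Nonempty A] {N : ℕ}
    (D : Fin N → Trajectory S A B) : S → PMF A :=
  empPolicy D fun x => x.2.1

/-- Behavior-cloning policy of player 2. -/
def nuHat [DecidableEq S] [DecidableEq B] [Fintype B] [Nonempty B] {N : ℕ}
    (D : Fin N → Trajectory S A B) : S → PMF B :=
  empPolicy D fun x => x.2.2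

end

end BehaviorCloning

end

/-! Let `μs` and `νs` be best responses to the learned policies `ν` and `μ`. The equilibrium
inequalities `J μs νE ≤ J μE νE ≤ J μE νs` bound the Nash gap by `(J μs ν - J μs νE) + (J μE νs - J
μ νs)`, so each bracket replaces one learned policy by the expert's against a fixed opponent. The
performance difference bound `J_sub_le_l1dist` charges each bracket to the `ℓ¹` imitation error,
weighted by the occupancy of the expert policy paired with a best response. These are the
occupancies that `Cmax` compares with the expert occupancy `ρ`.

It remains to bound the `ρ`-weighted imitation error. The last state of a geometric-length
trajectory has law `ρ`, which gives a lower tail for the visit counts (`measure_visits_le`).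
Hoeffding's lemma turns the action choices at a state into an exponential supermartingale, which
controls every sign pattern even though the number of visits is random (`measure_deviation_le`). A
union over sign patterns yields `ℓ¹` accuracy. Rarely visited states cost little because of their
weight; this gives an error of order `√(ρ s / N)` per state (`measure_weighted_error_gt_le`), and
Cauchy-Schwarz sums these to `√(|S| / N)`. -/

noncomputable section

/-! ### Finite expectations and the `ℓ¹` distance. -/

namespace PMF

/-- Expectation of a real function under a probability mass function on a finite type. -/
def expect {α : Type*} [Fintype α] (p : PMF α) (f : α → ℝ) : ℝ :=
  ∑ x, (p x).toReal * f x

/-- The `ℓ¹` distance of two probability mass functions. -/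
def l1dist {α : Type*} [Fintype α] (p q : PMF α) : ℝ :=
  ∑ x, |(p x).toReal - (q x).toReal|

section

variable {α β : Type*} [Fintype α] [Fintype β]

theorem sum_toReal (p : PMF α) : ∑ x, (p x).toReal = 1 := by
  rw [← ENNReal.toReal_sum (fun x _ => p.apply_ne_top x), ← ENNReal.toReal_one, ← p.tsum_coe,
    tsum_fintype]

theorem expect_const (p : PMF α) (c : ℝ) : p.expect (fun _ => c) = c := by
  rw [expect, ← Finset.sum_mul, p.sum_toReal, one_mul]

theorem expect_add (p : PMF α) (f g : α → ℝ) :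
    p.expect (fun x => f x + g x) = p.expect f + p.expect g := by
  simp only [expect, mul_add, Finset.sum_add_distrib]

theorem expect_sub (p : PMF α) (f g : α → ℝ) :
    p.expect (fun x => f x - g x) = p.expect f - p.expect g := by
  simp only [expect, mul_sub, Finset.sum_sub_distrib]

theorem expect_const_mul (p : PMF α) (c : ℝ) (f : α → ℝ) :
    p.expect (fun x => c * f x) = c * p.expect f := by
  simp only [expect, Finset.mul_sum, mul_left_comm]

theorem expect_neg (p : PMF α) (f : α → ℝ) :
    p.expect (fun x => -f x) = -p.expect f := by
  simp only [expect, mul_neg, Finset.sum_neg_distrib]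

theorem expect_mono (p : PMF α) {f g : α → ℝ} (h : ∀ x, f x ≤ g x) : p.expect f ≤ p.expect g :=
  Finset.sum_le_sum fun x _ => mul_le_mul_of_nonneg_left (h x) ENNReal.toReal_nonneg

theorem expect_le (p : PMF α) {f : α → ℝ} {c : ℝ} (h : ∀ x, f x ≤ c) : p.expect f ≤ c :=
  (p.expect_mono h).trans_eq (p.expect_const c)

theorem abs_expect_le (p : PMF α) {f : α → ℝ} {c : ℝ} (h : ∀ x, |f x| ≤ c) :
    |p.expect f| ≤ c := by
  rw [abs_le]
  refine ⟨?_, p.expect_le fun x => (abs_le.1 (h x)).2⟩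
  exact (p.expect_const (-c)).symm.trans_le (p.expect_mono fun x => (abs_le.1 (h x)).1)

theorem toReal_bind_apply {β : Type*} (p : PMF α) (q : α → PMF β) (y : β) :
    (p.bind q y).toReal = p.expect fun x => (q x y).toReal := by
  rw [bind_apply, tsum_fintype, ENNReal.toReal_sum fun x _ =>
    ENNReal.mul_ne_top (p.apply_ne_top x) ((q x).apply_ne_top y)]
  simp only [ENNReal.toReal_mul, expect]

theorem expect_bind (p : PMF α) (q : α → PMF β) (f : β → ℝ) :
    (p.bind q).expect f = p.expect fun x => (q x).expect f := by
  rw [expect]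
  simp only [toReal_bind_apply, expect, Finset.sum_mul, Finset.mul_sum]
  rw [Finset.sum_comm]
  simp only [mul_assoc]

theorem expect_pure (a : α) (f : α → ℝ) : (PMF.pure a).expect f = f a := by
  classical
  rw [expect, Finset.sum_eq_single a]
  · simp
  · intro b _ hb
    simp [pure_apply_of_ne _ _ hb]
  · simp

theorem expect_map (p : PMF α) (g : α → β) (f : β → ℝ) :
    (p.map g).expect f = p.expect fun x => f (g x) := by
  rw [← bind_pure_comp, expect_bind]
  simp only [Function.comp, expect_pure]

theorem toReal_eq_expect [DecidableEq α] (p : PMF α) (a : α) :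
    (p a).toReal = p.expect fun x => if x = a then 1 else 0 := by
  simp [expect]

theorem expect_sub_expect_le (p q : PMF α) {f : α → ℝ} {c : ℝ} (h : ∀ x, |f x| ≤ c) :
    p.expect f - q.expect f ≤ p.l1dist q * c := by
  rw [expect, expect, l1dist, ← Finset.sum_sub_distrib, Finset.sum_mul]
  refine Finset.sum_le_sum fun x _ => ?_
  rw [← sub_mul]
  refine (le_abs_self _).trans ?_
  rw [abs_mul]
  exact mul_le_mul_of_nonneg_left (h x) (abs_nonneg _)

theorem l1dist_nonneg (p q : PMF α) : 0 ≤ p.l1dist q :=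
  Finset.sum_nonneg fun _ _ => abs_nonneg _

theorem l1dist_le_two (p q : PMF α) : p.l1dist q ≤ 2 := by
  have h : p.l1dist q ≤ ∑ x, ((p x).toReal + (q x).toReal) :=
    Finset.sum_le_sum fun x _ => by
      refine (abs_sub _ _).trans_eq ?_
      rw [abs_of_nonneg ENNReal.toReal_nonneg, abs_of_nonneg ENNReal.toReal_nonneg]
  rw [Finset.sum_add_distrib, sum_toReal, sum_toReal] at h
  linarith

theorem l1dist_eq_zero_of_subsingleton [Subsingleton α] (p q : PMF α) : p.l1dist q = 0 := by
  refine Finset.sum_eq_zero fun x _ => ?_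
  have key : ∀ r : PMF α, (r x).toReal = 1 := fun r => by
    rw [← r.sum_toReal, Finset.sum_eq_single x (fun b _ hb => absurd (Subsingleton.elim b x) hb)
      (by simp)]
  rw [key, key, sub_self, abs_zero]

end

end PMF

/-! ### Bellman equations, best responses and performance difference. -/

namespace ZeroSumMarkovGame

open PMF

section

variable {S A B : Type*} (G : ZeroSumMarkovGame S A B) (μ : S → PMF A) (ν : S → PMF B)

/-- The reward as a function of state and action pair. -/
def stepReward (x : S × A × B) : ℝ := G.r x.1 x.2.1 x.2.2

theorem abs_stepReward_le (x : S × A × B) : |G.stepReward x| ≤ 1 := by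
  have := G.r_mem x.1 x.2.1 x.2.2
  exact abs_le.2 this

theorem occupancy_nonneg (s : S) : 0 ≤ G.occupancy μ ν s :=
  mul_nonneg (by linarith [G.γ_lt_one])
    (tsum_nonneg fun t => mul_nonneg (pow_nonneg G.γ_nonneg t) ENNReal.toReal_nonneg)

/-- A bound on `supRatio` is a pointwise domination. -/
theorem occupancy_le_of_supRatio {S : Type*} {d ρ : S → ℝ} {C : ℝ≥0∞} (hρ : ∀ s, 0 ≤ ρ s) (hC : C ≠ ∞)
    (h : supRatio d ρ ≤ C) (s : S) : d s ≤ C.toReal * ρ s := by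
  have h1 : ENNReal.ofReal (d s) / ENNReal.ofReal (ρ s) ≤ C :=
    (le_iSup (fun s => ENNReal.ofReal (d s) / ENNReal.ofReal (ρ s)) s).trans h
  have h2 : ENNReal.ofReal (d s) ≤ C * ENNReal.ofReal (ρ s) := by
    rwa [ENNReal.div_le_iff_le_mul (Or.inr hC) (Or.inl ENNReal.ofReal_ne_top)] at h1
  rw [← ENNReal.ofReal_toReal hC, ← ENNReal.ofReal_mul ENNReal.toReal_nonneg] at h2
  exact (ENNReal.ofReal_le_ofReal_iff (mul_nonneg ENNReal.toReal_nonneg (hρ s))).1 h2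

variable [Fintype S] [Fintype A] [Fintype B]

theorem expect_actLaw (s : S) (f : S × A × B → ℝ) :
    (actLaw μ ν s).expect f = (μ s).expect fun a => (ν s).expect fun b => f (s, a, b) := by
  simp only [actLaw, expect_bind, expect_map]

/-- Discounted value `E_{μ,ν}[∑_t γ^t f(S_t, A_t, B_t) | S_0 = s]` of a per-step payoff `f`. -/
def discVal (f : S × A × B → ℝ) (s : S) : ℝ :=
  ∑' t : ℕ, G.γ ^ t * (G.stepLaw μ ν t s).expect f

theorem summable_discVal (f : S × A × B → ℝ) (s : S) :
    Summable fun t : ℕ => G.γ ^ t * (G.stepLaw μ ν t s).expect f := by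
  refine Summable.of_norm_bounded (g := fun t : ℕ => G.γ ^ t * ∑ x, |f x|)
    ((summable_geometric_of_lt_one G.γ_nonneg G.γ_lt_one).mul_right _) fun t => ?_
  rw [Real.norm_eq_abs, abs_mul, abs_of_nonneg (pow_nonneg G.γ_nonneg t)]
  exact mul_le_mul_of_nonneg_left (abs_expect_le _ fun x =>
    Finset.single_le_sum (f := fun x => |f x|) (fun _ _ => abs_nonneg _) (Finset.mem_univ x))
    (pow_nonneg G.γ_nonneg t)

theorem hasSum_discVal (f : S × A × B → ℝ) (s : S) :
    HasSum (fun t : ℕ => G.γ ^ t * (G.stepLaw μ ν t s).expect f) (G.discVal μ ν f s) :=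
  (G.summable_discVal μ ν f s).hasSum

/-- Expected payoff of one step followed by continuation values `V`. -/
def qVal (f : S × A × B → ℝ) (V : S → ℝ) (x : S × A × B) : ℝ :=
  f x + G.γ * (G.P x.1 x.2.1 x.2.2).expect V

theorem discVal_bellman (f : S × A × B → ℝ) (s : S) :
    G.discVal μ ν f s = (actLaw μ ν s).expect (G.qVal f (G.discVal μ ν f)) := by
  have h0 := (G.summable_discVal μ ν f s).tsum_eq_zero_add
  have h1 : HasSum (fun t : ℕ => G.γ ^ (t + 1) * (G.stepLaw μ ν (t + 1) s).expect f)
      ((actLaw μ ν s).expect fun x => G.γ * (G.P x.1 x.2.1 x.2.2).expect (G.discVal μ ν f)) := by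
    have : ∀ t : ℕ, G.γ ^ (t + 1) * (G.stepLaw μ ν (t + 1) s).expect f
        = ∑ x, (actLaw μ ν s x).toReal * (G.γ * ∑ s', (G.P x.1 x.2.1 x.2.2 s').toReal *
          (G.γ ^ t * (G.stepLaw μ ν t s').expect f)) := fun t => by
      simp only [stepLaw, expect_bind]
      rw [expect, Finset.mul_sum]
      refine Finset.sum_congr rfl fun x _ => ?_
      rw [expect, Finset.mul_sum, Finset.mul_sum, Finset.mul_sum, Finset.mul_sum]
      refine Finset.sum_congr rfl fun s' _ => ?_
      ring
    simp only [this]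
    exact hasSum_sum fun x _ => (((hasSum_sum fun s' _ =>
      (G.hasSum_discVal μ ν f s').mul_left _).mul_left _).mul_left _)
  rw [h1.tsum_eq, pow_zero, one_mul] at h0
  rw [discVal, h0]
  unfold qVal
  rw [expect_add]
  rfl

theorem abs_discVal_le {f : S × A × B → ℝ} (hf : ∀ x, |f x| ≤ 1) (s : S) :
    |G.discVal μ ν f s| ≤ (1 - G.γ)⁻¹ := by
  rw [← Real.norm_eq_abs]
  refine tsum_of_norm_bounded (hasSum_geometric_of_lt_one G.γ_nonneg G.γ_lt_one) fun t => ?_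
  rw [Real.norm_eq_abs, abs_mul, abs_of_nonneg (pow_nonneg G.γ_nonneg t)]
  exact mul_le_of_le_one_right (pow_nonneg G.γ_nonneg t) (abs_expect_le _ hf)

/-- Maximum principle: at a maximizer `m` the inequality reads `D m ≤ γ * D m`, and `γ < 1`. All
later comparisons of value functions go through this. -/
theorem nonpos_of_le_discounted {D : S → ℝ}
    (h : ∀ s, D s ≤ G.γ * (actLaw μ ν s).expect fun x => (G.P x.1 x.2.1 x.2.2).expect D) (s : S) :
    D s ≤ 0 := by
  obtain ⟨m, -, hm⟩ := Finset.exists_max_image Finset.univ D ⟨s, Finset.mem_univ s⟩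
  have h1 : D m ≤ G.γ * D m := (h m).trans (mul_le_mul_of_nonneg_left
    (expect_le _ fun x => expect_le _ fun s' => hm s' (Finset.mem_univ _)) G.γ_nonneg)
  have h2 := hm s (Finset.mem_univ _)
  have := G.γ_lt_one
  nlinarith

/-- The Bellman equation makes `V` minus the value a subsolution of the homogeneous equation, so the
maximum principle applies. -/
theorem le_discVal {f : S × A × B → ℝ} {V : S → ℝ}
    (h : ∀ s, V s ≤ (actLaw μ ν s).expect (G.qVal f V)) (s : S) : V s ≤ G.discVal μ ν f s := by
  suffices V s - G.discVal μ ν f s ≤ 0 by linarith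
  refine G.nonpos_of_le_discounted μ ν (D := fun s => V s - G.discVal μ ν f s) (fun s => ?_) s
  have h1 := h s
  have h2 := G.discVal_bellman μ ν f s
  unfold qVal at h1 h2
  simp only [expect_add, expect_const_mul, expect_sub] at h1 h2 ⊢
  rw [mul_sub]
  linarith

theorem discVal_le {f : S × A × B → ℝ} {V : S → ℝ}
    (h : ∀ s, (actLaw μ ν s).expect (G.qVal f V) ≤ V s) (s : S) : G.discVal μ ν f s ≤ V s := by
  suffices G.discVal μ ν f s - V s ≤ 0 by linarith
  refine G.nonpos_of_le_discounted μ ν (D := fun s => G.discVal μ ν f s - V s) (fun s => ?_) s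
  have h1 := h s
  have h2 := G.discVal_bellman μ ν f s
  unfold qVal at h1 h2
  simp only [expect_add, expect_const_mul, expect_sub] at h1 h2 ⊢
  rw [mul_sub]
  linarith

theorem value_eq_discVal : G.value μ ν = G.discVal μ ν G.stepReward := rfl

theorem J_eq_expect : G.J μ ν = G.d0.expect (G.value μ ν) := rfl

/-- Some deterministic stationary policy is a best response. -/
theorem brMax_nonempty [Nonempty A] : (G.brMax ν).Nonempty := by
  classical
  let V : (S → A) → S → ℝ := fun π => G.discVal (fun s => PMF.pure (π s)) ν G.stepReward
  -- Maximizing the unweighted sum over all states, not the `d0`-average, makes a strict gain at any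
  -- single state contradict optimality, even where `d0` vanishes.
  obtain ⟨π, -, hπ⟩ := Finset.exists_max_image (Finset.univ : Finset (S → A))
    (fun π => ∑ s, V π s) Finset.univ_nonempty
  let Q : S → A → ℝ := fun s a => (ν s).expect fun b => G.qVal G.stepReward (V π) (s, a, b)
  have hV : ∀ s, V π s = Q s (π s) := fun s => by
    have := G.discVal_bellman (fun s => PMF.pure (π s)) ν G.stepReward s
    rwa [expect_actLaw, expect_pure] at this
  -- Policy improvement: switching to a better action at `s` alone loses nowhere and gains strictly
  -- at `s`.
  have hQ : ∀ s a, Q s a ≤ V π s := by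
    intro s a
    by_contra hlt
    rw [not_le] at hlt
    let π' := Function.update π s a
    have h1 : ∀ s', V π s' ≤ (actLaw (fun s => PMF.pure (π' s)) ν s').expect
        (G.qVal G.stepReward (V π)) := fun s' => by
      rw [expect_actLaw, expect_pure]
      by_cases hs : s' = s
      · subst hs
        simpa [π'] using hlt.le
      · have : π' s' = π s' := Function.update_of_ne hs _ _
        rw [this]
        exact (hV s').le
    have h2 : ∀ s', V π s' ≤ V π' s' := G.le_discVal _ _ h1
    have h3 : V π s < V π' s := by
      have h4 := G.discVal_bellman (fun s => PMF.pure (π' s)) ν G.stepReward s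
      rw [expect_actLaw, expect_pure] at h4
      have h5 : π' s = a := Function.update_self _ _ _
      rw [h5] at h4
      refine hlt.trans_le (le_of_le_of_eq ?_ h4.symm)
      refine expect_mono _ fun b => ?_
      unfold qVal
      have := mul_le_mul_of_nonneg_left (expect_mono (G.P s a b) h2) G.γ_nonneg
      simpa using this
    exact absurd (hπ π' (Finset.mem_univ _)) (not_le.2
      (Finset.sum_lt_sum (fun s' _ => h2 s') ⟨s, Finset.mem_univ s, h3⟩))
  refine ⟨fun s => PMF.pure (π s), fun μ' => ?_⟩
  rw [J_eq_expect, J_eq_expect]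
  -- By `hQ`, `V π` is a supersolution for every policy, randomized ones included.
  refine expect_mono _ fun s => G.discVal_le μ' ν (V := V π) (fun s => ?_) s
  rw [expect_actLaw]
  exact expect_le _ fun a => hQ s a

/-- Occupancy is the normalized discounted value of a state indicator; expanding `ε` in indicators
gives the rest by linearity. -/
theorem expect_discVal_fst (ε : S → ℝ) :
    G.d0.expect (G.discVal μ ν fun x => ε x.1)
      = (1 - G.γ)⁻¹ * ∑ s, G.occupancy μ ν s * ε s := by
  classical
  have h1 : ∀ s, G.occupancy μ ν s = (1 - G.γ) *
      G.d0.expect (G.discVal μ ν fun x => if x.1 = s then 1 else 0) := fun s => by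
    rw [occupancy]
    congr 1
    have : HasSum (fun t : ℕ => ∑ s0, (G.d0 s0).toReal * (G.γ ^ t *
        (G.stepLaw μ ν t s0).expect fun x => if x.1 = s then 1 else 0))
        (G.d0.expect (G.discVal μ ν fun x => if x.1 = s then 1 else 0)) :=
      hasSum_sum fun s0 _ => (G.hasSum_discVal μ ν _ s0).mul_left _
    rw [← this.tsum_eq]
    congr 1
    funext t
    rw [toReal_bind_apply, expect, Finset.mul_sum]
    refine Finset.sum_congr rfl fun s0 _ => ?_
    rw [toReal_eq_expect (map _ _), expect_map]
    ring
  have h2 : ∀ s0, G.discVal μ ν (fun x => ε x.1) s0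
      = ∑ s, ε s * G.discVal μ ν (fun x => if x.1 = s then 1 else 0) s0 := fun s0 => by
    have h3 : HasSum (fun t : ℕ => ∑ s, ε s * (G.γ ^ t *
        (G.stepLaw μ ν t s0).expect fun x => if x.1 = s then 1 else 0)) _ :=
      hasSum_sum fun s _ => (G.hasSum_discVal μ ν (fun x => if x.1 = s then 1 else 0) s0).mul_left _
    rw [← h3.tsum_eq, discVal]
    congr 1
    funext t
    simp only [expect, Finset.mul_sum]
    rw [Finset.sum_comm]
    refine Finset.sum_congr rfl fun x _ => ?_
    simp
    ring
  have hγ : (1 - G.γ) ≠ 0 := by have := G.γ_lt_one; linarith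
  simp only [h1]
  rw [Finset.mul_sum]
  rw [show G.discVal μ ν (fun x => ε x.1) = _ from funext h2]
  simp only [expect, Finset.mul_sum, Finset.sum_mul]
  rw [Finset.sum_comm]
  refine Finset.sum_congr rfl fun s _ => Finset.sum_congr rfl fun s0 _ => ?_
  field_simp

theorem sum_occupancy : ∑ s, G.occupancy μ ν s = 1 := by
  have h := G.expect_discVal_fst μ ν fun _ => 1
  have h1 : ∀ s, G.discVal μ ν (fun _ => 1) s = (1 - G.γ)⁻¹ := fun s => by
    simp only [discVal, expect_const, mul_one]
    exact tsum_geometric_of_lt_one G.γ_nonneg G.γ_lt_one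
  rw [show G.discVal μ ν (fun _ => 1) = _ from funext h1, expect_const] at h
  have hγ : (1 - G.γ) ≠ 0 := by have := G.γ_lt_one; linarith
  field_simp at h
  simpa using h.symm

/-- Performance difference bound for two policies of the second player. -/
theorem J_sub_le_l1dist (ν' : S → PMF B) :
    G.J μ ν - G.J μ ν' ≤
      ((1 - G.γ) ^ 2)⁻¹ * ∑ s, G.occupancy μ ν' s * (ν s).l1dist (ν' s) := by
  have hγ : 0 < 1 - G.γ := by have := G.γ_lt_one; linarith
  -- One-step loss from changing the second player's action law: `ℓ¹` distance times the sup bound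
  -- on the action values of `V`.
  let ε : S → ℝ := fun s => (ν s).l1dist (ν' s) * (1 - G.γ)⁻¹
  let V := G.discVal μ ν G.stepReward
  let V' := G.discVal μ ν' G.stepReward
  let W := G.discVal μ ν' fun x => ε x.1
  have hQ : ∀ x, |G.qVal G.stepReward V x| ≤ (1 - G.γ)⁻¹ := fun x => by
    have h1 := G.abs_stepReward_le x
    have h2 : |(G.P x.1 x.2.1 x.2.2).expect V| ≤ (1 - G.γ)⁻¹ :=
      abs_expect_le _ fun s => G.abs_discVal_le μ ν G.abs_stepReward_le s
    refine (abs_add_le _ _).trans ?_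
    rw [abs_mul, abs_of_nonneg G.γ_nonneg]
    have h3 := mul_le_mul_of_nonneg_left h2 G.γ_nonneg
    have h4 : 1 + G.γ * (1 - G.γ)⁻¹ = (1 - G.γ)⁻¹ := by field_simp; ring
    linarith
  -- The losses are accumulated along the process of `(μ, ν')`, so it is the occupancy of `ν'` that
  -- appears.
  have hD : ∀ s, V s - V' s - W s ≤ 0 := by
    refine G.nonpos_of_le_discounted μ ν' fun s => ?_
    have h1 : V s - (actLaw μ ν' s).expect (G.qVal G.stepReward V) ≤ ε s := by
      rw [show V s = _ from G.discVal_bellman μ ν G.stepReward s, expect_actLaw, expect_actLaw,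
        ← expect_sub]
      exact expect_le _ fun a => expect_sub_expect_le _ _ fun b => hQ _
    have h2 : V' s = (actLaw μ ν' s).expect (G.qVal G.stepReward V') :=
      G.discVal_bellman μ ν' G.stepReward s
    have h3 : W s = (actLaw μ ν' s).expect (G.qVal (fun x => ε x.1) W) :=
      G.discVal_bellman μ ν' _ s
    have h4 : (actLaw μ ν' s).expect (fun x => ε x.1) = ε s := by
      simp only [expect_actLaw, expect_const]
    unfold qVal at h1 h2 h3
    simp only [expect_add, expect_const_mul, expect_sub, h4] at h1 h2 h3 ⊢
    linarith
  have h5 : G.J μ ν - G.J μ ν' ≤ G.d0.expect W := by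
    rw [J_eq_expect, J_eq_expect, ← expect_sub]
    exact expect_mono _ fun s => by
      have := hD s
      simp only [value_eq_discVal]
      linarith
  refine h5.trans_eq ?_
  rw [show G.d0.expect W = _ from G.expect_discVal_fst μ ν' ε, Finset.mul_sum, Finset.mul_sum]
  refine Finset.sum_congr rfl fun s _ => ?_
  simp only [ε]
  field_simp

end

/-! ### Exchanging the players and bounding the Nash gap. -/

section

variable {S A B : Type*} (G : ZeroSumMarkovGame S A B) (μ : S → PMF A) (ν : S → PMF B)

/-- The game with the roles of the two players exchanged. -/
def swap : ZeroSumMarkovGame S B A where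
  P s b a := G.P s a b
  r s b a := -G.r s a b
  r_mem s b a := by
    have := G.r_mem s a b
    constructor <;> linarith [this.1, this.2]
  γ := G.γ
  γ_nonneg := G.γ_nonneg
  γ_lt_one := G.γ_lt_one
  d0 := G.d0

theorem actLaw_swap (s : S) :
    actLaw ν μ s = (actLaw μ ν s).map fun x => (x.1, x.2.2, x.2.1) := by
  simp only [actLaw, PMF.map_bind, PMF.map_comp]
  simp only [← PMF.bind_pure_comp]
  rw [PMF.bind_comm]
  rfl

theorem stepLaw_swap (t : ℕ) (s : S) :
    G.swap.stepLaw ν μ t s = (G.stepLaw μ ν t s).map fun x => (x.1, x.2.2, x.2.1) := by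
  induction t generalizing s with
  | zero => exact actLaw_swap μ ν s
  | succ t ih =>
    simp only [stepLaw, ih, actLaw_swap μ ν, PMF.map_bind, PMF.bind_map]
    rfl

theorem occupancy_swap (s : S) : G.swap.occupancy ν μ s = G.occupancy μ ν s := by
  simp only [occupancy, stepLaw_swap, PMF.map_comp]
  rfl

variable [Fintype S] [Fintype A] [Fintype B]

theorem J_swap : G.swap.J ν μ = -G.J μ ν := by
  have : ∀ s, G.swap.value ν μ s = -G.value μ ν s := fun s => by
    rw [value_eq_discVal, value_eq_discVal, discVal, discVal, ← tsum_neg]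
    congr 1
    funext t
    rw [stepLaw_swap, expect_map, ← mul_neg, ← expect_neg]
    rfl
  rw [J_eq_expect, J_eq_expect, show G.swap.value ν μ = _ from funext this, expect_neg]
  rfl

theorem brMax_swap : G.swap.brMax μ = G.brMin μ := by
  ext ν
  simp only [brMax, brMin, Set.mem_ofPred_eq, J_swap, neg_le_neg_iff]

theorem brMin_nonempty [Nonempty B] : (G.brMin μ).Nonempty := by
  rw [← brMax_swap]
  exact G.swap.brMax_nonempty μ

/-- The Nash gap is controlled by the `ℓ¹` distances to an equilibrium pair. -/
theorem nashGap_le [Nonempty A] [Nonempty B] {μE : S → PMF A} {νE : S → PMF B}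
    (hE : G.IsNash μE νE) : ∃ μs ∈ G.brMax ν, ∃ νs ∈ G.brMin μ,
      G.nashGap μ ν ≤ ((1 - G.γ) ^ 2)⁻¹ * ∑ s, (G.occupancy μE νs s * (μ s).l1dist (μE s) +
        G.occupancy μs νE s * (ν s).l1dist (νE s)) := by
  obtain ⟨μs, hμs⟩ := G.brMax_nonempty ν
  obtain ⟨νs, hνs⟩ := G.brMin_nonempty μ
  refine ⟨μs, hμs, νs, hνs, ?_⟩
  rw [G.nashGap_eq μ μs ν νs hμs hνs, Finset.sum_add_distrib, mul_add]
  have h1 := G.J_sub_le_l1dist μs ν νE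
  have h2 := G.swap.J_sub_le_l1dist νs μ μE
  simp only [J_swap, occupancy_swap] at h2
  -- The equilibrium inequalities let `J μs νE` and `J μE νs` be inserted between the two terms of
  -- the gap.
  have h3 := hE.1 μs
  have h4 := hE.2 νs
  have h5 : G.swap.γ = G.γ := rfl
  rw [h5] at h2
  linarith

/-- Each occupancy in `nashGap_le` pairs an expert policy with a best response, so `Cmax` dominates
it by a multiple of the expert occupancy. Finiteness matters because `toReal` sends `∞` to `0`. -/
theorem nashGap_le_Cmax_mul [Nonempty A] [Nonempty B] {μE : S → PMF A} {νE : S → PMF B}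
    (hE : G.IsNash μE νE) (hC : G.Cmax μE νE ≠ ∞) :
      G.nashGap μ ν ≤ (G.Cmax μE νE).toReal * (((1 - G.γ) ^ 2)⁻¹ *
        ∑ s, G.occupancy μE νE s * ((μ s).l1dist (μE s) + (ν s).l1dist (νE s))) := by
  obtain ⟨μs, hμs, νs, hνs, h⟩ := G.nashGap_le μ ν hE
  refine h.trans ?_
  rw [mul_left_comm]
  refine mul_le_mul_of_nonneg_left ?_ (by positivity)
  rw [Finset.mul_sum]
  refine Finset.sum_le_sum fun s _ => ?_
  have h1 : G.occupancy μE νs s ≤ (G.Cmax μE νE).toReal * G.occupancy μE νE s :=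
    occupancy_le_of_supRatio (G.occupancy_nonneg μE νE) hC
      (le_max_of_le_left <| le_iSup_of_le μ <|
        le_biSup (fun ν' => supRatio (G.occupancy μE ν') (G.occupancy μE νE)) hνs) s
  have h2 : G.occupancy μs νE s ≤ (G.Cmax μE νE).toReal * G.occupancy μE νE s :=
    occupancy_le_of_supRatio (G.occupancy_nonneg μE νE) hC
      (le_max_of_le_right <| le_iSup_of_le ν <|
        le_biSup (fun μ' => supRatio (G.occupancy μ' νE) (G.occupancy μE νE)) hμs) s
  have h3 := mul_le_mul_of_nonneg_right h1 (l1dist_nonneg (μ s) (μE s))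
  have h4 := mul_le_mul_of_nonneg_right h2 (l1dist_nonneg (ν s) (νE s))
  rw [← mul_assoc, mul_add]
  linarith

end

end ZeroSumMarkovGame

end

noncomputable section

/-! ### Exponential moments and independent samples. -/

namespace PMF

/-- Expectation of an extended nonnegative function under a probability mass function. -/
def lexpect {α : Type*} (p : PMF α) (f : α → ℝ≥0∞) : ℝ≥0∞ :=
  ∑' x, p x * f x

section

variable {α β : Type*}

theorem lexpect_const (p : PMF α) (c : ℝ≥0∞) : p.lexpect (fun _ => c) = c := by
  rw [lexpect, ENNReal.tsum_mul_right, p.tsum_coe, one_mul]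

theorem lexpect_add (p : PMF α) (f g : α → ℝ≥0∞) :
    p.lexpect (fun x => f x + g x) = p.lexpect f + p.lexpect g := by
  simp only [lexpect, mul_add, ENNReal.tsum_add]

theorem lexpect_const_mul (p : PMF α) (c : ℝ≥0∞) (f : α → ℝ≥0∞) :
    p.lexpect (fun x => c * f x) = c * p.lexpect f := by
  simp only [lexpect, mul_left_comm _ c, ENNReal.tsum_mul_left]

theorem lexpect_mono (p : PMF α) {f g : α → ℝ≥0∞} (h : ∀ x, f x ≤ g x) :
    p.lexpect f ≤ p.lexpect g :=
  ENNReal.tsum_le_tsum fun x => mul_le_mul_right (h x) (p x)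

theorem lexpect_le (p : PMF α) {f : α → ℝ≥0∞} {c : ℝ≥0∞} (h : ∀ x, f x ≤ c) :
    p.lexpect f ≤ c :=
  (p.lexpect_mono h).trans_eq (p.lexpect_const c)

theorem lexpect_bind (p : PMF α) (q : α → PMF β) (f : β → ℝ≥0∞) :
    (p.bind q).lexpect f = p.lexpect fun x => (q x).lexpect f := by
  simp only [lexpect, bind_apply, ← ENNReal.tsum_mul_right, ← ENNReal.tsum_mul_left]
  rw [ENNReal.tsum_comm]
  simp only [mul_assoc]

theorem lexpect_pure (a : α) (f : α → ℝ≥0∞) : (PMF.pure a).lexpect f = f a := by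
  rw [lexpect, tsum_eq_single a]
  · simp
  · intro b hb
    simp [pure_apply_of_ne _ _ hb]

theorem lexpect_map (p : PMF α) (g : α → β) (f : β → ℝ≥0∞) :
    (p.map g).lexpect f = p.lexpect fun x => f (g x) := by
  rw [← bind_pure_comp, lexpect_bind]
  simp only [Function.comp, lexpect_pure]

theorem lexpect_indicator [DecidableEq α] (p : PMF α) (a : α) :
    p.lexpect (fun x => if x = a then 1 else 0) = p a := by
  rw [lexpect, tsum_eq_single a]
  · simp
  · intro b hb
    simp [hb]

theorem lexpect_ofReal [Fintype α] (p : PMF α) {f : α → ℝ} (hf : ∀ x, 0 ≤ f x) :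
    p.lexpect (fun x => ENNReal.ofReal (f x)) = ENNReal.ofReal (p.expect f) := by
  rw [lexpect, tsum_fintype, expect, ENNReal.ofReal_sum_of_nonneg fun x _ =>
    mul_nonneg ENNReal.toReal_nonneg (hf x)]
  refine Finset.sum_congr rfl fun x _ => ?_
  rw [ENNReal.ofReal_mul ENNReal.toReal_nonneg, ENNReal.ofReal_toReal (p.apply_ne_top x)]

theorem lintegral_toMeasure [Countable α] [MeasurableSpace α] [MeasurableSingletonClass α]
    (p : PMF α) (f : α → ℝ≥0∞) : ∫⁻ x, f x ∂p.toMeasure = p.lexpect f := by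
  rw [lintegral_countable']
  simp only [toMeasure_apply_singleton _ _ (measurableSet_singleton _), lexpect, mul_comm]

/-- Hoeffding's lemma for functions with values in `[-1, 1]` on a finite probability space. -/
theorem expect_exp_le [Fintype α] (p : PMF α) {σ : α → ℝ} (hσ : ∀ x, σ x ∈ Set.Icc (-1 : ℝ) 1)
    (θ : ℝ) : p.expect (fun x => Real.exp (θ * (σ x - p.expect σ))) ≤ Real.exp (θ ^ 2 / 2) := by
  let _ : MeasurableSpace α := ⊤
  have h := (hasSubgaussianMGF_of_mem_Icc (μ := p.toMeasure) (X := σ) (a := -1) (b := 1)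
    (measurable_from_top.aemeasurable) (Filter.Eventually.of_forall hσ)).mgf_le θ
  simp only [mgf, integral_eq_sum, smul_eq_mul] at h
  refine (show _ = _ from rfl).trans_le (h.trans_eq ?_)
  congr 1
  norm_num

/-- Markov's inequality for products over independent samples. -/
theorem measure_pi_prod_ge_le [Countable α] [MeasurableSpace α] [DiscreteMeasurableSpace α]
    (p : PMF α) (N : ℕ) (F : α → ℝ≥0∞) {c : ℝ≥0∞} (hc : c ≠ 0) (hc' : c ≠ ∞) :
    (Measure.pi fun _ : Fin N => p.toMeasure) {D | c ≤ ∏ k, F (D k)} ≤ p.lexpect F ^ N / c := by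
  have hm : ∀ k : Fin N, Measurable fun D : Fin N → α => F (D k) := fun k =>
    (Measurable.of_discrete (f := F)).comp (measurable_pi_apply k)
  have hind : iIndepFun (fun (k : Fin N) (D : Fin N → α) => F (D k))
      (Measure.pi fun _ : Fin N => p.toMeasure) :=
    iIndepFun_pi (X := fun _ => F) fun _ => (Measurable.of_discrete (f := F)).aemeasurable
  have h1 := lintegral_prod_eq_prod_lintegral_of_indepFun Finset.univ _ hind hm
  have h2 : ∀ k : Fin N, ∫⁻ D, F (D k) ∂(Measure.pi fun _ : Fin N => p.toMeasure)
      = p.lexpect F := fun k => by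
    rw [← lintegral_toMeasure]
    exact (measurePreserving_eval (fun _ : Fin N => p.toMeasure) k).lintegral_comp
      (Measurable.of_discrete (f := F))
  refine (meas_ge_le_lintegral_div
    (Finset.measurable_fun_prod _ fun k _ => hm k).aemeasurable hc hc').trans_eq ?_
  rw [h1]
  simp [h2]

end

end PMF

/-! ### Supermartingales along a trajectory and visit counts. -/

namespace ZeroSumMarkovGame

open PMF

section

variable {S A B : Type*} (G : ZeroSumMarkovGame S A B) (μ : S → PMF A) (ν : S → PMF B)

theorem lexpect_actLaw (s : S) (f : S × A × B → ℝ≥0∞) :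
    (actLaw μ ν s).lexpect f = (μ s).lexpect fun a => (ν s).lexpect fun b => f (s, a, b) := by
  simp only [actLaw, lexpect_bind, lexpect_map]

theorem actLaw_map_fst (s : S) : (actLaw μ ν s).map (fun x => x.2.1) = μ s := by
  simp only [actLaw, PMF.map_bind, PMF.map_comp]
  have : ∀ a : A, ((fun x : S × A × B => x.2.1) ∘ fun b => (s, a, b)) = Function.const B a :=
    fun a => rfl
  simp only [this, PMF.map_const, PMF.bind_pure]

theorem actLaw_map_snd (s : S) : (actLaw μ ν s).map (fun x => x.2.2) = ν s := by
  simp only [actLaw, PMF.map_bind, PMF.map_comp]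
  have : ∀ a : A, ((fun x : S × A × B => x.2.2) ∘ fun b => (s, a, b)) = id := fun a => rfl
  simp only [this, PMF.map_id, PMF.bind_const]

/-- A product of per-step factors with conditional mean at most `1` is a supermartingale. -/
theorem lexpect_rollout_prod_le_one {g : S × A × B → ℝ≥0∞}
    (hg : ∀ s, (actLaw μ ν s).lexpect g ≤ 1) (n : ℕ) (s : S) :
    (G.rollout μ ν n s).lexpect (fun l => (l.map g).prod) ≤ 1 := by
  induction n generalizing s with
  | zero => simp [rollout, lexpect_pure]
  | succ n ih =>
    simp only [rollout, lexpect_bind, lexpect_map, List.map_cons, List.prod_cons,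
      lexpect_const_mul]
    refine (lexpect_mono _ fun x => ?_).trans (hg s)
    exact mul_le_of_le_one_right' (lexpect_le _ fun s' => ih s')

/-- The bound is uniform in the length and the initial state, so it survives averaging over both. -/
theorem lexpect_trajLaw_prod_le_one {g : S × A × B → ℝ≥0∞}
    (hg : ∀ s, (actLaw μ ν s).lexpect g ≤ 1) :
    (G.trajLaw μ ν).lexpect (fun l => (l.map g).prod) ≤ 1 := by
  simp only [trajLaw, lexpect_bind]
  exact lexpect_le _ fun n => lexpect_le _ fun s => G.lexpect_rollout_prod_le_one μ ν hg _ s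

theorem stopProb_ne_zero : G.stopProb ≠ 0 := fun h => by
  have h1 : (G.stopProb : ℝ) = 0 := by rw [h]; rfl
  have h2 : (1 : ℝ) - G.γ = 0 := h1
  linarith [G.γ_lt_one]

/-- The occupancy is the law of the state at a geometric random time. -/
theorem lexpect_geometric_eq_occupancy (s : S) :
    (geometricMeasure G.stopProb).toPMF.lexpect
      (fun n => (G.d0.bind fun s0 => (G.stepLaw μ ν n s0).map Prod.fst) s)
      = ENNReal.ofReal (G.occupancy μ ν s) := by
  set q : ℕ → PMF S := fun n => G.d0.bind fun s0 => (G.stepLaw μ ν n s0).map Prod.fst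
  have hγ := G.γ_lt_one
  have hnn : ∀ n, 0 ≤ G.γ ^ n * (q n s).toReal := fun n =>
    mul_nonneg (pow_nonneg G.γ_nonneg n) ENNReal.toReal_nonneg
  have hsum : Summable fun n => G.γ ^ n * (q n s).toReal := by
    refine Summable.of_nonneg_of_le hnn (fun n => ?_)
      (summable_geometric_of_lt_one G.γ_nonneg hγ)
    exact mul_le_of_le_one_right (pow_nonneg G.γ_nonneg n)
      (ENNReal.toReal_le_of_le_ofReal zero_le_one (by simpa using (q n).coe_le_one s))
  rw [occupancy, ← tsum_mul_left, ENNReal.ofReal_tsum_of_nonneg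
    (fun n => mul_nonneg (by linarith) (hnn n)) (hsum.mul_left _), lexpect]
  refine tsum_congr fun n => ?_
  have h1 : (G.stopProb : ℝ) = 1 - G.γ := rfl
  rw [Measure.toPMF_apply, geometricMeasure_singleton G.stopProb_ne_zero, h1, sub_sub_cancel,
    ← mul_assoc, ENNReal.ofReal_mul (mul_nonneg (by linarith) (pow_nonneg G.γ_nonneg n)),
    ENNReal.ofReal_toReal ((q n).apply_ne_top s), mul_comm (1 - G.γ)]

/-- The exponential moment of the number of visits in one trajectory. -/
theorem lexpect_exp_neg_visits_le [DecidableEq S] (s : S) :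
    (G.trajLaw μ ν).lexpect (fun l => ENNReal.ofReal
      (Real.exp (-(l.countP fun x => x.1 = s : ℕ)))) ≤
      ENNReal.ofReal (Real.exp (-((1 - Real.exp (-1)) * G.occupancy μ ν s))) := by
  set F : Trajectory S A B → ℝ≥0∞ := fun l => ENNReal.ofReal
      (Real.exp (-(l.countP fun x => x.1 = s : ℕ)))
  have he : Real.exp (-1) < 1 := by rw [Real.exp_lt_one_iff]; norm_num
  set c : ℝ≥0∞ := ENNReal.ofReal (1 - Real.exp (-1))
  -- Seeing `s` at position `n` forces at least one visit, so `F l ≤ exp (-1) = 1 - c` there.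
  have h1 : ∀ (n : ℕ) (l : Trajectory S A B),
      F l + c * (if (l[n]?).map Prod.fst = some s then 1 else 0) ≤ 1 := fun n l => by
    split_ifs with h
    · have hc : 1 ≤ l.countP fun x => x.1 = s := by
        rw [Nat.one_le_iff_ne_zero, ← Nat.pos_iff_ne_zero, List.countP_pos_iff]
        rw [Option.map_eq_some_iff] at h
        obtain ⟨x, hx, hxs⟩ := h
        exact ⟨x, List.mem_of_getElem? hx, by simpa using hxs⟩
      have h2 : Real.exp (-(l.countP fun x => x.1 = s : ℕ)) ≤ Real.exp (-1) := by
        rw [Real.exp_le_exp, neg_le_neg_iff]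
        exact_mod_cast hc
      rw [mul_one, ← ENNReal.ofReal_add (Real.exp_pos _).le (by linarith)]
      exact ENNReal.ofReal_le_one.2 (by linarith)
    · rw [mul_zero, add_zero]
      exact ENNReal.ofReal_le_one.2 (Real.exp_le_one_iff.2 (by simp))
  -- Index `n` is the last position of a rollout of length `n + 1`; with `n` geometric from `0`, the
  -- state there has the occupancy as its law.
  have h3 : ∀ (n : ℕ) (s0 : S), (G.rollout μ ν (n + 1) s0).lexpect F +
      c * ((G.stepLaw μ ν n s0).map Prod.fst) s ≤ 1 := fun n s0 => by
    have h4 : ((G.stepLaw μ ν n s0).map Prod.fst) s = (G.rollout μ ν (n + 1) s0).lexpect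
        fun l => if (l[n]?).map Prod.fst = some s then 1 else 0 := by
      rw [← lexpect_map _ (fun l : Trajectory S A B => l[n]?)
        (fun o => if o.map Prod.fst = some s then 1 else 0),
        rollout_map_getElem? G μ ν (n + 1) n n.lt_succ_self, lexpect_map, ← lexpect_indicator,
        lexpect_map]
      simp
    rw [h4, ← lexpect_const_mul, ← lexpect_add]
    exact lexpect_le _ fun l => h1 n l
  have h5 : (G.trajLaw μ ν).lexpect F + c * ENNReal.ofReal (G.occupancy μ ν s) ≤ 1 := by
    rw [← lexpect_geometric_eq_occupancy, trajLaw, lexpect_bind, ← lexpect_const_mul,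
      ← lexpect_add]
    refine lexpect_le _ fun n => ?_
    have h6 : (G.d0.bind fun s0 => (G.stepLaw μ ν n s0).map Prod.fst) s
        = G.d0.lexpect fun s0 => ((G.stepLaw μ ν n s0).map Prod.fst) s := PMF.bind_apply _ _ _
    rw [lexpect_bind, h6, ← lexpect_const_mul, ← lexpect_add]
    exact lexpect_le _ fun s0 => h3 n s0
  have hρ := G.occupancy_nonneg μ ν s
  rw [← ENNReal.ofReal_mul (by linarith)] at h5
  refine (ENNReal.le_sub_of_add_le_right ENNReal.ofReal_ne_top h5).trans ?_
  rw [← ENNReal.ofReal_one, ← ENNReal.ofReal_sub _ (mul_nonneg (by linarith) hρ)]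
  refine ENNReal.ofReal_le_ofReal ?_
  have := Real.add_one_le_exp (-((1 - Real.exp (-1)) * G.occupancy μ ν s))
  linarith

end

end ZeroSumMarkovGame

end

noncomputable section

/-! ### Deviation of the empirical policies. -/

namespace BehaviorCloning

open PMF ZeroSumMarkovGame

section

/-- The sign pattern that is `1` on `T` and `-1` off `T`. -/
def signOn {C : Type*} [DecidableEq C] (T : Finset C) (c : C) : ℝ := if c ∈ T then 1 else -1

theorem signOn_mem {C : Type*} [DecidableEq C] (T : Finset C) (c : C) : signOn T c ∈ Set.Icc (-1 : ℝ) 1 := by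
  unfold signOn
  split_ifs <;> norm_num

variable {S A B C : Type*} [DecidableEq S] [Fintype C]

/-- The exponential factor of one visit in the empirical deviation of `σ` at `s`. -/
def devFactor (act : S × A × B → C) (p : PMF C) (σ : C → ℝ) (θ : ℝ) (s : S) (x : S × A × B) :
    ℝ≥0∞ :=
  if x.1 = s then ENNReal.ofReal (Real.exp (θ * (σ (act x) - p.expect σ) - θ ^ 2 / 2)) else 1

/-- At `s`, the compensator `θ ^ 2 / 2` cancels the bound of Hoeffding's lemma; at other states the
factor is `1`. -/
theorem lexpect_devFactor_le_one (μ : S → PMF A) (ν : S → PMF B) (act : S × A × B → C)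
    (π : S → PMF C) (hact : ∀ s, (actLaw μ ν s).map act = π s) {σ : C → ℝ}
    (hσ : ∀ c, σ c ∈ Set.Icc (-1 : ℝ) 1) (θ : ℝ) (s s' : S) :
    (actLaw μ ν s').lexpect (devFactor act (π s) σ θ s) ≤ 1 := by
  by_cases h : s' = s
  · subst h
    have h1 : (actLaw μ ν s').lexpect (devFactor act (π s') σ θ s') =
        (actLaw μ ν s').lexpect fun x => ENNReal.ofReal
          (Real.exp (θ * (σ (act x) - (π s').expect σ) - θ ^ 2 / 2)) := by
      simp only [lexpect_actLaw, devFactor, if_true]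
    rw [h1, ← lexpect_map _ act (fun c => ENNReal.ofReal
          (Real.exp (θ * (σ c - (π s').expect σ) - θ ^ 2 / 2))), hact,
      lexpect_ofReal _ fun c => (Real.exp_pos _).le, ENNReal.ofReal_le_one]
    have h2 := (π s').expect_exp_le hσ θ
    simp only [sub_eq_add_neg _ (θ ^ 2 / 2), Real.exp_add]
    simp only [mul_comm _ (Real.exp (-(θ ^ 2 / 2))), expect_const_mul]
    refine (mul_le_mul_of_nonneg_left h2 (Real.exp_pos _).le).trans_eq ?_
    rw [← Real.exp_add, neg_add_cancel, Real.exp_zero]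
  · simp only [lexpect_actLaw, devFactor, if_neg h, lexpect_const, le_refl]

variable [DecidableEq C]

theorem prod_devFactor (act : S × A × B → C) (p : PMF C) (σ : C → ℝ) (θ : ℝ) (s : S)
    (l : Trajectory S A B) :
    (l.map (devFactor act p σ θ s)).prod = ENNReal.ofReal (Real.exp
      (θ * (∑ c, σ c * (l.countP fun x => x.1 = s ∧ act x = c : ℕ)
        - (l.countP fun x => x.1 = s : ℕ) * p.expect σ)
        - (l.countP fun x => x.1 = s : ℕ) * (θ ^ 2 / 2))) := by
  induction l with
  | nil => simp
  | cons x l ih =>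
    rw [List.map_cons, List.prod_cons, ih, devFactor]
    by_cases h : x.1 = s
    · rw [if_pos h, ← ENNReal.ofReal_mul (Real.exp_pos _).le, ← Real.exp_add]
      congr 2
      simp [List.countP_cons, h, mul_add, Finset.sum_add_distrib]
      ring
    · rw [if_neg h, one_mul]
      simp [h]

/-- Exponential deviation inequality for the empirical action frequencies, self-normalized by the
random number of visits. -/
theorem measure_deviation_le [Fintype S] [Fintype A] [Fintype B] (G : ZeroSumMarkovGame S A B)
    (μ : S → PMF A) (ν : S → PMF B) (act : S × A × B → C)
    (π : S → PMF C) (hact : ∀ s, (actLaw μ ν s).map act = π s) {σ : C → ℝ}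
    (hσ : ∀ c, σ c ∈ Set.Icc (-1 : ℝ) 1) (θ Λ : ℝ) (s : S) (N : ℕ) :
    G.dataLaw μ ν N {D | Λ ≤ θ * (∑ c, σ c * actionVisits D act s c
      - visits D s * (π s).expect σ) - visits D s * (θ ^ 2 / 2)} ≤ ENNReal.ofReal (Real.exp (-Λ)) := by
  have h1 := G.lexpect_trajLaw_prod_le_one μ ν
    (lexpect_devFactor_le_one μ ν act π hact hσ θ s)
  have h2 := measure_pi_prod_ge_le (G.trajLaw μ ν) N
    (fun l => (l.map (devFactor act (π s) σ θ s)).prod) (c := ENNReal.ofReal (Real.exp Λ))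
    (by simpa using Real.exp_pos Λ) ENNReal.ofReal_ne_top
  have h3 : (G.trajLaw μ ν).lexpect (fun l => (l.map (devFactor act (π s) σ θ s)).prod) ^ N
      / ENNReal.ofReal (Real.exp Λ) ≤ ENNReal.ofReal (Real.exp (-Λ)) := by
    rw [Real.exp_neg, ENNReal.ofReal_inv_of_pos (Real.exp_pos _), ← one_div]
    exact ENNReal.div_le_div_right (pow_le_one' h1 N) _
  refine le_trans (le_of_eq ?_) (h2.trans h3)
  rw [dataLaw]
  congr 1
  ext D
  simp only [Set.mem_ofPred_eq, prod_devFactor]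
  rw [← ENNReal.ofReal_prod_of_nonneg fun _ _ => (Real.exp_pos _).le, ← Real.exp_sum,
    ENNReal.ofReal_le_ofReal_iff (Real.exp_pos _).le, Real.exp_le_exp]
  have h4 : ∑ k, (θ * (∑ c, σ c * ((D k).countP fun x => x.1 = s ∧ act x = c : ℕ)
        - ((D k).countP fun x => x.1 = s : ℕ) * (π s).expect σ)
        - ((D k).countP fun x => x.1 = s : ℕ) * (θ ^ 2 / 2))
      = θ * (∑ c, σ c * actionVisits D act s c
      - visits D s * (π s).expect σ) - visits D s * (θ ^ 2 / 2) := by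
    rw [Finset.sum_sub_distrib, ← Finset.mul_sum, Finset.sum_sub_distrib, Finset.sum_comm,
      ← Finset.sum_mul, ← Finset.sum_mul]
    simp only [visits, actionVisits, Nat.cast_sum, Finset.mul_sum]
  rw [h4]

/-- Lower tail of the number of visits of a state. -/
theorem measure_visits_le [Fintype S] [Fintype A] [Fintype B] (G : ZeroSumMarkovGame S A B)
    (μ : S → PMF A) (ν : S → PMF B) (m : ℝ) (s : S) (N : ℕ) :
    G.dataLaw μ ν N {D | (visits D s : ℝ) ≤ m} ≤ ENNReal.ofReal
      (Real.exp (m - N * ((1 - Real.exp (-1)) * G.occupancy μ ν s))) := by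
  have h2 := measure_pi_prod_ge_le (G.trajLaw μ ν) N (fun l => ENNReal.ofReal
      (Real.exp (-(l.countP fun x => x.1 = s : ℕ)))) (c := ENNReal.ofReal (Real.exp (-m)))
    (by simpa using Real.exp_pos (-m)) ENNReal.ofReal_ne_top
  have h3 : (G.trajLaw μ ν).lexpect (fun l => ENNReal.ofReal
      (Real.exp (-(l.countP fun x => x.1 = s : ℕ)))) ^ N / ENNReal.ofReal (Real.exp (-m)) ≤
      ENNReal.ofReal (Real.exp (m - N * ((1 - Real.exp (-1)) * G.occupancy μ ν s))) := by
    refine (ENNReal.div_le_div_right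
      (pow_le_pow_left' (G.lexpect_exp_neg_visits_le μ ν s) N) _).trans_eq ?_
    rw [← ENNReal.ofReal_pow (Real.exp_pos _).le, ← ENNReal.ofReal_div_of_pos (Real.exp_pos _),
      ← Real.exp_nat_mul, ← Real.exp_sub]
    congr 2
    ring
  refine le_trans (le_of_eq ?_) (h2.trans h3)
  rw [dataLaw]
  congr 1
  ext D
  simp only [Set.mem_ofPred_eq]
  rw [← ENNReal.ofReal_prod_of_nonneg fun _ _ => (Real.exp_pos _).le, ← Real.exp_sum,
    ENNReal.ofReal_le_ofReal_iff (Real.exp_pos _).le, Real.exp_le_exp, Finset.sum_neg_distrib,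
    neg_le_neg_iff, visits, Nat.cast_sum]

/-- The sign pattern of the difference of the two laws attains the `ℓ¹` distance. With `n` visits,
its deviation bound gives `θ * n * ℓ¹ ≤ Λ + n * θ ^ 2 / 2`, and `Λ = m * θ ^ 2 / 2 ≤ n * θ ^ 2 / 2`.
-/
theorem l1dist_empPolicy_le [Nonempty C] {N : ℕ} (D : Fin N → Trajectory S A B)
    (act : S × A × B → C) (p : PMF C) (s : S) {θ Λ m : ℝ} (hθ : 0 < θ) (hm : 0 < m)
    (hmθ : m * θ ^ 2 = 2 * Λ) (hn : m ≤ visits D s)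
    (h : ∀ T : Finset C, θ * (∑ c, signOn T c * actionVisits D act s c
      - visits D s * p.expect (signOn T)) - visits D s * (θ ^ 2 / 2) ≤ Λ) :
    (empPolicy D act s).l1dist p ≤ θ := by
  have hn0 : (0 : ℝ) < visits D s := hm.trans_le hn
  have hv : visits D s ≠ 0 := by exact_mod_cast hn0.ne'
  have hemp : ∀ c, (empPolicy D act s c).toReal = (actionVisits D act s c : ℝ) / visits D s :=
    fun c => by
      rw [empPolicy, dif_neg hv, ofFintype_apply, ENNReal.toReal_div]
      simp
  let T : Finset C := Finset.univ.filter fun c => 0 ≤ (empPolicy D act s c).toReal - (p c).toReal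
  have h1 : (visits D s : ℝ) * (empPolicy D act s).l1dist p =
      ∑ c, signOn T c * actionVisits D act s c - visits D s * p.expect (signOn T) := by
    rw [l1dist, expect, Finset.mul_sum, Finset.mul_sum, ← Finset.sum_sub_distrib]
    refine Finset.sum_congr rfl fun c _ => ?_
    have h2 : |(empPolicy D act s c).toReal - (p c).toReal|
        = signOn T c * ((empPolicy D act s c).toReal - (p c).toReal) := by
      by_cases hc : 0 ≤ (empPolicy D act s c).toReal - (p c).toReal
      · have : c ∈ T := by simpa [T] using hc
        rw [signOn, if_pos this, one_mul, abs_of_nonneg hc]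
      · have : c ∉ T := by simpa [T] using hc
        rw [signOn, if_neg this, abs_of_neg (not_le.1 hc), neg_one_mul]
    rw [h2, hemp]
    field_simp
  have h2 := h T
  rw [← h1] at h2
  have h3 : (visits D s : ℝ) * (empPolicy D act s).l1dist p ≤ visits D s * θ := by
    have h4 : m * θ ^ 2 ≤ visits D s * θ ^ 2 := mul_le_mul_of_nonneg_right hn (sq_nonneg θ)
    have h5 : θ * (visits D s * (empPolicy D act s).l1dist p) ≤ θ * (visits D s * θ) := by
      nlinarith
    exact le_of_mul_le_mul_left h5 hθ
  exact le_of_mul_le_mul_left h3 hn0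

end

end BehaviorCloning

end

noncomputable section

/-! ### Weighted error: one state, then all states. -/

namespace BehaviorCloning

open PMF ZeroSumMarkovGame

section

/-- On the event of at least `m` visits, the empirical policy is `ℓ¹`-accurate. -/
theorem measure_l1dist_empPolicy_gt_le {S A B C : Type*} [DecidableEq S] [Fintype C]
    [DecidableEq C] [Fintype S] [Fintype A] [Fintype B] [Nonempty C]
    (G : ZeroSumMarkovGame S A B) (μ : S → PMF A) (ν : S → PMF B) (act : S × A × B → C)
    (π : S → PMF C) (hact : ∀ s, (actLaw μ ν s).map act = π s) (s : S) (N : ℕ)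
    {θ Λ m : ℝ} (hθ : 0 < θ) (hm : 0 < m) (hmθ : m * θ ^ 2 = 2 * Λ) :
    G.dataLaw μ ν N {D | m ≤ visits D s ∧ θ < (empPolicy D act s).l1dist (π s)} ≤
      ENNReal.ofReal (2 ^ Fintype.card C * Real.exp (-Λ)) := by
  have hsub : {D : Fin N → Trajectory S A B |
      m ≤ visits D s ∧ θ < (empPolicy D act s).l1dist (π s)} ⊆
      ⋃ T : Finset C, {D | Λ ≤ θ * (∑ c, signOn T c * actionVisits D act s c
      - visits D s * (π s).expect (signOn T)) - visits D s * (θ ^ 2 / 2)} := by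
    rintro D ⟨hD, hlt⟩
    by_contra hD'
    simp only [Set.mem_iUnion, Set.mem_ofPred_eq, not_exists, not_le] at hD'
    exact absurd (l1dist_empPolicy_le D act (π s) s hθ hm hmθ hD fun T => (hD' T).le)
      (not_le.2 hlt)
  refine (measure_mono hsub).trans ((measure_iUnion_le _).trans ?_)
  rw [tsum_fintype]
  refine (Finset.sum_le_sum fun T _ =>
    measure_deviation_le G μ ν act π hact (signOn_mem T) θ Λ s N).trans_eq ?_
  rw [Finset.sum_const, Finset.card_univ, Fintype.card_finset, nsmul_eq_mul,
    ENNReal.ofReal_mul (by positivity)]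
  congr 1
  rw [ENNReal.ofReal_pow (by norm_num)]
  norm_num

/-- Follows from `(ρ * θ) ^ 2 = (n * ρ * θ ^ 2) * (ρ / n)`. It serves both the trivial radius `2`
and the statistical radius. -/
theorem mul_le_of_sq_le {ρ n θ M L : ℝ} (hρ : 0 ≤ ρ) (hn : 0 < n) (hM : 0 ≤ M)
    (hL : 0 ≤ L) (h : n * ρ * θ ^ 2 ≤ 16 * M * L ^ 2) :
    ρ * θ ≤ 4 * √M * L * √(ρ / n) := by
  refine (le_abs_self _).trans (abs_le_of_sq_le_sq ?_ (by positivity))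
  have h1 : (4 * √M * L * √(ρ / n)) ^ 2 = 16 * M * L ^ 2 * (ρ / n) := by
    rw [mul_pow, mul_pow, mul_pow, Real.sq_sqrt hM, Real.sq_sqrt (by positivity)]
    ring
  rw [h1]
  have h2 : (ρ * θ) ^ 2 = n * ρ * θ ^ 2 * (ρ / n) := by
    field_simp
  rw [h2]
  exact mul_le_mul_of_nonneg_right h (by positivity)

variable {S A B : Type*} [Fintype S] [DecidableEq S] [Fintype A] [DecidableEq A] [Nonempty A]
  [Fintype B] [DecidableEq B] [Nonempty B]

/-- Weighted `ℓ¹` error of behavior cloning at one state. -/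
theorem measure_weighted_error_gt_le (G : ZeroSumMarkovGame S A B) (μ : S → PMF A)
    (ν : S → PMF B) (s : S) {N : ℕ} (hN : 0 < N) {δ : ℝ} (hδ0 : 0 < δ) (hδ1 : δ < 1) :
    G.dataLaw μ ν N {D | 8 * √(max (Fintype.card A) (Fintype.card B) : ℕ) *
        Real.log (2 * (Fintype.card S : ℝ) / δ) * √(G.occupancy μ ν s / N) <
      G.occupancy μ ν s * ((muHat D s).l1dist (μ s) + (nuHat D s).l1dist (ν s))} ≤
      ENNReal.ofReal (δ / Fintype.card S) := by
  have hN' : (0 : ℝ) < N := by exact_mod_cast hN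
  have hS : (1 : ℝ) ≤ Fintype.card S := by
    exact_mod_cast Fintype.card_pos_iff.2 ⟨s⟩
  have hAM : Fintype.card A ≤ max (Fintype.card A) (Fintype.card B) := le_max_left _ _
  have hBM : Fintype.card B ≤ max (Fintype.card A) (Fintype.card B) := le_max_right _ _
  set M : ℕ := max (Fintype.card A) (Fintype.card B)
  set L : ℝ := Real.log (2 * (Fintype.card S : ℝ) / δ) with hLdef
  have hρ := G.occupancy_nonneg μ ν s
  set ρ : ℝ := G.occupancy μ ν s
  have hb : 0.6931471803 < Real.log 2 := Real.log_two_gt_d9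
  have hLb : Real.log 2 ≤ L := by
    refine Real.log_le_log two_pos ?_
    rw [le_div_iff₀ hδ0]
    nlinarith
  have hL : 0 < L := by linarith
  have hempty : ∀ x : ℝ, (∀ D : Fin N → Trajectory S A B, (muHat D s).l1dist (μ s) ≤ x ∧
      (nuHat D s).l1dist (ν s) ≤ x) → ρ * x ≤ 4 * √M * L * √(ρ / N) →
      G.dataLaw μ ν N {D | 8 * √M * L * √(ρ / N) <
        ρ * ((muHat D s).l1dist (μ s) + (nuHat D s).l1dist (ν s))} = 0 := by
    intro x hx hle
    convert measure_empty (μ := G.dataLaw μ ν N)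
    refine Set.eq_empty_iff_forall_notMem.2 fun D hD => ?_
    rw [Set.mem_ofPred_eq] at hD
    refine hD.not_ge ?_
    have h1 := mul_le_mul_of_nonneg_left (add_le_add (hx D).1 (hx D).2) hρ
    linarith
  -- With single actions there is no error; otherwise `2 ≤ M`, which `Λ ≤ 2 * M * L` needs.
  rcases Nat.lt_or_ge M 2 with hM1 | hM2
  · have hA1 : Subsingleton A := Fintype.card_le_one_iff_subsingleton.1 (by omega)
    have hB1 : Subsingleton B := Fintype.card_le_one_iff_subsingleton.1 (by omega)
    rw [hempty 0 (fun D => ⟨(l1dist_eq_zero_of_subsingleton _ _).le,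
      (l1dist_eq_zero_of_subsingleton _ _).le⟩) (by rw [mul_zero]; positivity)]
    exact zero_le
  -- At this threshold the trivial bound `2` on each distance already suffices.
  rcases le_or_gt (N * ρ) (4 * M * L ^ 2) with hsmall | hlarge
  · rw [hempty 2 (fun D => ⟨l1dist_le_two _ _, l1dist_le_two _ _⟩)
      (mul_le_of_sq_le hρ hN' (Nat.cast_nonneg M) hL.le (by linarith))]
    exact zero_le
  have hM : (2 : ℝ) ≤ M := by exact_mod_cast hM2
  have hx : 0 < N * ρ := lt_of_le_of_lt (by positivity) hlarge
  -- `M * log 2` pays for the sign patterns, `L` gives `δ / (2|S|)`, and the last `log 2` splits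
  -- that between the two players.
  set Λ : ℝ := M * Real.log 2 + L + Real.log 2 with hΛ
  have hΛpos : 0 < Λ := by positivity
  have hΛle : 5 * Λ ≤ 16 * M * L ^ 2 := by
    have h1 : L * (0.6931471803) ≤ L ^ 2 := by nlinarith
    have h2 : Λ ≤ 2 * M * L := by
      rw [hΛ]
      nlinarith
    nlinarith
  set θ : ℝ := √(5 * Λ / (N * ρ)) with hθ
  have hθpos : 0 < θ := Real.sqrt_pos.2 (by positivity)
  have hθsq : N * ρ * θ ^ 2 = 5 * Λ := by
    rw [hθ, Real.sq_sqrt (by positivity), mul_div_cancel₀ _ hx.ne']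
  -- Since `2 / 5 < 1 - exp (-1)`, the visit tail keeps an exponent of at least `0.2321 * N * ρ`,
  -- which exceeds `L` for `N * ρ` above the threshold.
  set m : ℝ := 2 / 5 * (N * ρ) with hm
  have hmpos : 0 < m := by positivity
  have hmθ : m * θ ^ 2 = 2 * Λ := by
    rw [hm]
    linarith
  have hθle : ρ * θ ≤ 4 * √M * L * √(ρ / N) :=
    mul_le_of_sq_le hρ hN' (Nat.cast_nonneg M) hL.le (by rw [hθsq]; exact hΛle)
  have hsub : {D : Fin N → Trajectory S A B | 8 * √M * L * √(ρ / N) <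
        ρ * ((muHat D s).l1dist (μ s) + (nuHat D s).l1dist (ν s))} ⊆
      {D | (visits D s : ℝ) ≤ m} ∪
      ({D | m ≤ visits D s ∧ θ < (muHat D s).l1dist (μ s)} ∪
        {D | m ≤ visits D s ∧ θ < (nuHat D s).l1dist (ν s)}) := by
    intro D hD
    by_contra hD'
    simp only [Set.mem_union, Set.mem_ofPred_eq, not_or, not_le, not_and, not_lt] at hD'
    obtain ⟨h1, h2, h3⟩ := hD'
    rw [Set.mem_ofPred_eq] at hD
    refine hD.not_ge ?_
    have h4 := mul_le_mul_of_nonneg_left (add_le_add (h2 h1.le) (h3 h1.le)) hρ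
    linarith
  have hexpL : Real.exp (-L) = δ / (2 * Fintype.card S) := by
    rw [Real.exp_neg, hLdef, Real.exp_log (by positivity), inv_div]
  have hexpΛ : Real.exp (-Λ) = (2 ^ M)⁻¹ * (δ / (4 * Fintype.card S)) := by
    rw [hΛ, neg_add, neg_add, Real.exp_add, Real.exp_add, hexpL, Real.exp_neg, Real.exp_neg,
      Real.exp_nat_mul, Real.exp_log two_pos]
    field_simp
    norm_num
  have hdev : ∀ k : ℕ, k ≤ M → (2 : ℝ) ^ k * Real.exp (-Λ) ≤ δ / (4 * Fintype.card S) :=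
    fun k hk => by
      rw [hexpΛ, ← mul_assoc]
      refine mul_le_of_le_one_left (by positivity) ?_
      rw [mul_inv_le_iff₀ (by positivity), one_mul]
      exact pow_le_pow_right₀ one_le_two hk
  have hvis : Real.exp (m - N * ((1 - Real.exp (-1)) * ρ)) ≤ δ / (2 * Fintype.card S) := by
    rw [← hexpL, Real.exp_le_exp, hm]
    have he : Real.exp (-1) < 0.3679 := by
      rw [Real.exp_neg, inv_lt_comm₀ (Real.exp_pos _) (by norm_num)]
      refine lt_trans ?_ Real.exp_one_gt_d9
      norm_num
    have h1 : L ≤ 0.2321 * (N * ρ) := by nlinarith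
    nlinarith
  have h1 := measure_visits_le G μ ν m s N
  have h2 := measure_l1dist_empPolicy_gt_le G μ ν (fun x => x.2.1) μ (actLaw_map_fst μ ν) s N
    hθpos hmpos hmθ
  have h3 := measure_l1dist_empPolicy_gt_le G μ ν (fun x => x.2.2) ν (actLaw_map_snd μ ν) s N
    hθpos hmpos hmθ
  refine (measure_mono hsub).trans ((measure_union_le _ _).trans
    ((add_le_add_right (measure_union_le _ _) _).trans ?_))
  have h4 : δ / Fintype.card S = δ / (2 * Fintype.card S) +
      (δ / (4 * Fintype.card S) + δ / (4 * Fintype.card S)) := by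
    field_simp
    norm_num
  rw [h4, ENNReal.ofReal_add (by positivity) (by positivity),
    ENNReal.ofReal_add (by positivity) (by positivity)]
  exact add_le_add (h1.trans (ENNReal.ofReal_le_ofReal hvis))
    (add_le_add (h2.trans (ENNReal.ofReal_le_ofReal (hdev _ hAM)))
      (h3.trans (ENNReal.ofReal_le_ofReal (hdev _ hBM))))

/-- Weighted `ℓ¹` error of behavior cloning, summed over all states. -/
theorem measure_sum_weighted_error_le (G : ZeroSumMarkovGame S A B) (μ : S → PMF A)
    (ν : S → PMF B) {N : ℕ} (hN : 0 < N) {δ : ℝ} (hδ0 : 0 < δ) (hδ1 : δ < 1) :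
    ENNReal.ofReal (1 - δ) ≤ G.dataLaw μ ν N {D | ∑ s, G.occupancy μ ν s *
        ((muHat D s).l1dist (μ s) + (nuHat D s).l1dist (ν s)) ≤
      8 * √((Fintype.card S : ℝ) * (max (Fintype.card A) (Fintype.card B) : ℕ) *
        Real.log (2 * (Fintype.card S : ℝ) / δ) ^ 2 / N)} := by
  obtain ⟨s₀, -⟩ := G.d0.support_nonempty
  have hS : (1 : ℝ) ≤ Fintype.card S := by
    exact_mod_cast Fintype.card_pos_iff.2 ⟨s₀⟩
  have hN' : (0 : ℝ) < N := by exact_mod_cast hN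
  set M : ℕ := max (Fintype.card A) (Fintype.card B)
  set L : ℝ := Real.log (2 * (Fintype.card S : ℝ) / δ)
  have hL : 0 ≤ L := Real.log_nonneg (by rw [le_div_iff₀ hδ0]; linarith)
  let bad : S → Set (Fin N → Trajectory S A B) := fun s =>
    {D | 8 * √M * L * √(G.occupancy μ ν s / N) <
      G.occupancy μ ν s * ((muHat D s).l1dist (μ s) + (nuHat D s).l1dist (ν s))}
  have hbad : G.dataLaw μ ν N (⋃ s, bad s) ≤ ENNReal.ofReal δ := by
    refine (measure_iUnion_le _).trans ?_
    rw [tsum_fintype]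
    refine (Finset.sum_le_sum fun s _ =>
      measure_weighted_error_gt_le G μ ν s hN hδ0 hδ1).trans_eq ?_
    rw [← ENNReal.ofReal_sum_of_nonneg fun _ _ => by positivity, Finset.sum_const,
      Finset.card_univ, nsmul_eq_mul, mul_div_cancel₀ _ (by positivity)]
  -- Cauchy-Schwarz, with the occupancies summing to `1`.
  have hsqrt : ∑ s, √(G.occupancy μ ν s / N) ≤ √((Fintype.card S : ℝ) / N) := by
    refine Real.le_sqrt_of_sq_le ?_
    refine (sq_sum_le_card_mul_sum_sq).trans_eq ?_
    have h1 : ∀ s, √(G.occupancy μ ν s / N) ^ 2 = G.occupancy μ ν s / N := fun s =>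
      Real.sq_sqrt (div_nonneg (G.occupancy_nonneg μ ν s) hN'.le)
    simp only [h1]
    rw [← Finset.sum_div, G.sum_occupancy, Finset.card_univ, mul_one_div]
  have hsub : (⋃ s, bad s)ᶜ ⊆ {D | ∑ s, G.occupancy μ ν s *
        ((muHat D s).l1dist (μ s) + (nuHat D s).l1dist (ν s)) ≤
      8 * √((Fintype.card S : ℝ) * M * L ^ 2 / N)} := by
    intro D hD
    simp only [bad, Set.mem_compl_iff, Set.mem_iUnion, Set.mem_ofPred_eq, not_exists,
      not_lt] at hD ⊢
    refine (Finset.sum_le_sum fun s _ => hD s).trans ?_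
    rw [← Finset.mul_sum]
    have h2 : √((Fintype.card S : ℝ) * M * L ^ 2 / N) = √M * L * √((Fintype.card S : ℝ) / N) := by
      rw [show (Fintype.card S : ℝ) * M * L ^ 2 / N = M * L ^ 2 * ((Fintype.card S : ℝ) / N) by
        ring, Real.sqrt_mul (by positivity), Real.sqrt_mul (by positivity), Real.sqrt_sq hL]
    rw [h2]
    have := mul_le_mul_of_nonneg_left hsqrt (show 0 ≤ 8 * √M * L by positivity)
    linarith
  have hprob : IsProbabilityMeasure (G.dataLaw μ ν N) := by
    unfold dataLaw
    infer_instance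
  -- Subadditivity suffices here, so the bad event need not be shown measurable.
  have h3 : (1 : ℝ≥0∞) ≤ G.dataLaw μ ν N (⋃ s, bad s) + G.dataLaw μ ν N (⋃ s, bad s)ᶜ := by
    rw [← measure_univ (μ := G.dataLaw μ ν N), ← Set.union_compl_self (⋃ s, bad s)]
    exact measure_union_le _ _
  rw [ENNReal.ofReal_sub _ hδ0.le, ENNReal.ofReal_one]
  refine le_trans ?_ (measure_mono hsub)
  exact tsub_le_iff_left.2 (h3.trans (add_le_add_left hbad _))

end

end BehaviorCloning

end

/-! ### Combining the game-theoretic and statistical bounds. -/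

theorem theorem1 {S A B : Type*} [Fintype S] [DecidableEq S]
    [Fintype A] [DecidableEq A] [Nonempty A] [Fintype B] [DecidableEq B] [Nonempty B]
    (G : ZeroSumMarkovGame S A B) (μE : S → PMF A) (νE : S → PMF B) (hNash : G.IsNash μE νE)
    (N : ℕ) (hN : 0 < N) (δ : ℝ) (hδ0 : 0 < δ) (hδ1 : δ < 1) :
    ENNReal.ofReal (1 - δ) ≤ G.dataLaw μE νE N
      {D | ENNReal.ofReal (G.nashGap (BehaviorCloning.muHat D) (BehaviorCloning.nuHat D)) ≤
        G.Cmax μE νE * ENNReal.ofReal (8 / (1 - G.γ) ^ 2 *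
          Real.sqrt ((Fintype.card S : ℝ) * (max (Fintype.card A) (Fintype.card B) : ℕ) *
            Real.log (2 * (Fintype.card S : ℝ) / δ) ^ 2 / (N : ℝ)))} := by
  refine (BehaviorCloning.measure_sum_weighted_error_le G μE νE hN hδ0 hδ1).trans
    (measure_mono fun D hD => ?_)
  simp only [Set.mem_ofPred_eq] at hD ⊢
  have hγ : 0 < 1 - G.γ := by linarith [G.γ_lt_one]
  by_cases hC : G.Cmax μE νE = ∞
  · obtain ⟨s₀, -⟩ := G.d0.support_nonempty
    have hS : (1 : ℝ) ≤ Fintype.card S := by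
      exact_mod_cast Fintype.card_pos_iff.2 ⟨s₀⟩
    have hN' : (0 : ℝ) < N := by exact_mod_cast hN
    have hM : (0 : ℝ) < (max (Fintype.card A) (Fintype.card B) : ℕ) := by
      exact_mod_cast lt_max_of_lt_left Fintype.card_pos
    have hL : 0 < Real.log (2 * (Fintype.card S : ℝ) / δ) :=
      Real.log_pos (by rw [lt_div_iff₀ hδ0]; linarith)
    -- Since `∞ * 0 = 0`, the infinite case is trivial only because the other factor is positive.
    rw [hC, ENNReal.top_mul (by rw [Ne, ENNReal.ofReal_eq_zero, not_le]; positivity)]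
    exact le_top
  · have h1 := G.nashGap_le_Cmax_mul (BehaviorCloning.muHat D) (BehaviorCloning.nuHat D) hNash hC
    rw [← ENNReal.ofReal_toReal hC, ← ENNReal.ofReal_mul ENNReal.toReal_nonneg]
    refine ENNReal.ofReal_le_ofReal (h1.trans (mul_le_mul_of_nonneg_left ?_
      ENNReal.toReal_nonneg))
    refine (mul_le_mul_of_nonneg_left hD (by positivity)).trans_eq ?_
    rw [← mul_assoc, div_eq_inv_mul (8 : ℝ)]
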